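/- Let $L^2=L^2[0,1]$ be the complex Hilbert space with inner product $\langle f,g\rangle=\int_0^1 f\,\overline{g}\,dx$, let $H$ be the Hardy operator on $L^2$, $$Hf(x)=\frac1x\int_0^x f(t)\,dt ,$$ which is a bounded linear operator, and let $H^*$ be its Hilbert space adjoint. Let $\mathcal S=\{s\in\mathbb C:\operatorname{Re}s>-\tfrac12\}$, so that $x^s\in L^2$ for every $s\in\mathcal S$. Suppose $f(x)=\sum_{j=0}^N c_j x^{s_j}$ with $N\ge 0$, $c_j\in\mathbb C$ and each $s_j\in\mathcal S$. If $\langle f,x^t\rangle\neq0$ for every $t\in\mathcal S$, then $f$ is a cyclic vector for $H^*$, that is, the linear span of $\{(H^*)^nf:n=0,1,2,\dots\}$ is dense in $L^2$. -/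

import Mathlib

open MeasureTheory Set
open scoped ENNReal

namespace HardyOp

/-- Lebesgue measure on `[0,1]`. -/
noncomputable abbrev unitMeasure : Measure ℝ := volume.restrict (Icc (0 : ℝ) 1)

/-- The complex Hilbert space `L²[0,1]`. -/
abbrev L2 : Type := Lp ℂ 2 unitMeasure

/-- The half plane of all `s ∈ ℂ` with `Re s > -1/2`. -/
abbrev HalfPlane : Type := {s : ℂ // -(1 / 2 : ℝ) < s.re}

theorem memLp_monomial (s : HalfPlane) :
    MemLp (fun x : ℝ => (x : ℂ) ^ (s : ℂ)) 2 unitMeasure := by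
  have hm : Measurable (fun x : ℝ => (x : ℂ) ^ (s : ℂ)) := by fun_prop
  rw [memLp_two_iff_integrable_sq_norm hm.aestronglyMeasurable]
  have hs := s.2
  have h1 : IntegrableOn (fun x : ℝ => x ^ (2 * (s : ℂ).re)) (Ioc 0 1) := by
    have h := intervalIntegral.intervalIntegrable_rpow' (a := 0) (b := 1)
      (r := 2 * (s : ℂ).re) (by linarith)
    rwa [intervalIntegrable_iff_integrableOn_Ioc_of_le zero_le_one] at h
  have h2 : IntegrableOn (fun x : ℝ => ‖(x : ℂ) ^ (s : ℂ)‖ ^ 2) (Ioc 0 1) := by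
    refine h1.congr_fun (fun x hx => ?_) measurableSet_Ioc
    have hx0 : 0 < x := hx.1
    simp only
    rw [Complex.norm_cpow_eq_rpow_re_of_pos hx0, ← Real.rpow_natCast,
      ← Real.rpow_mul hx0.le]
    congr 1
    push_cast
    ring
  exact h2.congr_set_ae Ioc_ae_eq_Icc.symm

/-- The monomial function `x ↦ x ^ s`, as a vector of `L²[0,1]`. -/
noncomputable def monomial (s : HalfPlane) : L2 := (memLp_monomial s).toLp

/-- The function `x ↦ (1 / x) ∫₀ˣ f(t) dt`. -/
noncomputable def hardyFun (f : ℝ → ℂ) (x : ℝ) : ℂ := (x : ℂ)⁻¹ * ∫ t in (0 : ℝ)..x, f t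

theorem integrableOn_coe (f : L2) : IntegrableOn f (Icc (0 : ℝ) 1) :=
  (Lp.memLp f).integrable (by norm_num)

theorem aestronglyMeasurable_hardyFun (f : L2) :
    AEStronglyMeasurable (hardyFun f) unitMeasure := by
  have h1 : ContinuousOn (fun x : ℝ => ∫ t in (0 : ℝ)..x, f t) (Icc 0 1) := by
    have := intervalIntegral.continuousOn_primitive_interval (μ := volume) (f := f)
      (a := (0 : ℝ)) (b := 1) (by simpa [uIcc_of_le] using integrableOn_coe f)
    simpa [uIcc_of_le] using this
  have h2 : Measurable (fun x : ℝ => ((x : ℂ))⁻¹) := by fun_prop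
  exact h2.aestronglyMeasurable.mul (h1.aestronglyMeasurable measurableSet_Icc)

theorem lintegral_rpow_neg_half (x : ℝ) (hx : 0 < x) :
    ∫⁻ t in Ioc 0 x, ENNReal.ofReal (t ^ (-(1 / 2) : ℝ))
      = ENNReal.ofReal (2 * x ^ (1 / 2 : ℝ)) := by
  have h := intervalIntegral.intervalIntegrable_rpow' (a := 0) (b := x)
      (r := -(1 / 2 : ℝ)) (by norm_num)
  rw [intervalIntegrable_iff_integrableOn_Ioc_of_le hx.le] at h
  rw [← ofReal_integral_eq_lintegral_ofReal h, ← intervalIntegral.integral_of_le hx.le,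
    integral_rpow (Or.inl (by norm_num))]
  · congr 1
    norm_num
    ring
  · filter_upwards [ae_restrict_mem measurableSet_Ioc] with t ht
    exact Real.rpow_nonneg ht.1.le _

theorem lintegral_rpow_tail (t : ℝ) (ht : 0 < t) (ht1 : t ≤ 1) :
    ∫⁻ x in Icc t 1, ENNReal.ofReal (2 * x ^ (-(3 / 2) : ℝ))
      ≤ ENNReal.ofReal (4 * t ^ (-(1 / 2) : ℝ)) := by
  have h0 : (0 : ℝ) ∉ uIcc t 1 := by
    rw [uIcc_of_le ht1]; intro h; exact absurd h.1 (not_le.2 ht)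
  have h := (intervalIntegral.intervalIntegrable_rpow (μ := volume) (a := t) (b := 1)
      (r := -(3 / 2 : ℝ)) (Or.inr h0)).const_mul 2
  rw [intervalIntegrable_iff_integrableOn_Ioc_of_le ht1] at h
  rw [← restrict_Ioc_eq_restrict_Icc, ← ofReal_integral_eq_lintegral_ofReal h,
    ← intervalIntegral.integral_of_le ht1, intervalIntegral.integral_const_mul,
    integral_rpow (Or.inr ⟨by norm_num, h0⟩)]
  · apply ENNReal.ofReal_le_ofReal
    norm_num
    ring_nf
    linarith
  · filter_upwards [ae_restrict_mem measurableSet_Ioc] with x hx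
    exact mul_nonneg (by norm_num) (Real.rpow_nonneg (ht.trans hx.1).le _)

theorem enorm_hardyFun_sq_le (f : L2) (x : ℝ) (hx : 0 < x) :
    ‖hardyFun f x‖ₑ ^ 2 ≤ ENNReal.ofReal (2 * x ^ (-(3 / 2) : ℝ)) *
      ∫⁻ t in Ioc 0 x, ENNReal.ofReal (t ^ (1 / 2 : ℝ)) * ‖f t‖ₑ ^ 2 := by
  have hfm : Measurable (fun t : ℝ => ‖f t‖ₑ) := (Lp.stronglyMeasurable f).measurable.enorm
  have hI : ‖∫ t in (0 : ℝ)..x, f t‖ₑ ≤ ∫⁻ t in Ioc 0 x, ‖f t‖ₑ := by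
    rw [intervalIntegral.integral_of_le hx.le]
    exact enorm_integral_le_lintegral_enorm _
  have hCS : (∫⁻ t in Ioc 0 x, ‖f t‖ₑ) ^ 2 ≤ ENNReal.ofReal (2 * x ^ (1 / 2 : ℝ)) *
      ∫⁻ t in Ioc 0 x, ENNReal.ofReal (t ^ (1 / 2 : ℝ)) * ‖f t‖ₑ ^ 2 := by
    have h := ENNReal.lintegral_mul_le_Lp_mul_Lq (volume.restrict (Ioc 0 x))
      (p := 2) (q := 2) (by constructor <;> norm_num)
      (f := fun t => ENNReal.ofReal (t ^ (-(1 / 4) : ℝ)))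
      (g := fun t => ENNReal.ofReal (t ^ (1 / 4 : ℝ)) * ‖f t‖ₑ)
      (by fun_prop) (by fun_prop)
    have e1 : ∫⁻ t in Ioc 0 x, ‖f t‖ₑ = ∫⁻ t in Ioc 0 x,
        ((fun t => ENNReal.ofReal (t ^ (-(1 / 4) : ℝ))) *
          (fun t => ENNReal.ofReal (t ^ (1 / 4 : ℝ)) * ‖f t‖ₑ)) t := by
      refine setLIntegral_congr_fun measurableSet_Ioc (fun t ht => ?_)
      simp only [Pi.mul_apply]
      rw [← mul_assoc, ← ENNReal.ofReal_mul (Real.rpow_nonneg ht.1.le _),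
        ← Real.rpow_add ht.1]
      norm_num
    have e2 : ∫⁻ t in Ioc 0 x, (ENNReal.ofReal (t ^ (-(1 / 4) : ℝ))) ^ (2 : ℝ)
        = ENNReal.ofReal (2 * x ^ (1 / 2 : ℝ)) := by
      rw [← lintegral_rpow_neg_half x hx]
      refine setLIntegral_congr_fun measurableSet_Ioc (fun t ht => ?_)
      rw [ENNReal.ofReal_rpow_of_nonneg (Real.rpow_nonneg ht.1.le _) (by norm_num),
        ← Real.rpow_mul ht.1.le]
      norm_num
    have e3 : ∫⁻ t in Ioc 0 x, (ENNReal.ofReal (t ^ (1 / 4 : ℝ)) * ‖f t‖ₑ) ^ (2 : ℝ)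
        = ∫⁻ t in Ioc 0 x, ENNReal.ofReal (t ^ (1 / 2 : ℝ)) * ‖f t‖ₑ ^ 2 := by
      refine setLIntegral_congr_fun measurableSet_Ioc (fun t ht => ?_)
      rw [ENNReal.mul_rpow_of_nonneg _ _ (by norm_num : (0 : ℝ) ≤ 2),
        ENNReal.ofReal_rpow_of_nonneg (Real.rpow_nonneg ht.1.le _) (by norm_num),
        ← Real.rpow_mul ht.1.le]
      norm_num
    rw [← e1, e2, e3] at h
    calc _ ≤ _ := pow_le_pow_left' h 2
      _ = _ := by
        rw [mul_pow]
        simp only [← ENNReal.rpow_natCast, ← ENNReal.rpow_mul]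
        norm_num
  have hx1 : ‖((x : ℂ))⁻¹‖ₑ ^ 2 = ENNReal.ofReal (x ^ (-2 : ℝ)) := by
    rw [← ofReal_norm, ← ENNReal.ofReal_pow (norm_nonneg _)]
    congr 1
    rw [norm_inv, Complex.norm_real, Real.norm_of_nonneg hx.le, Real.rpow_neg hx.le]
    norm_num
  rw [hardyFun, enorm_mul, mul_pow, hx1]
  calc _ ≤ ENNReal.ofReal (x ^ (-2 : ℝ)) * (ENNReal.ofReal (2 * x ^ (1 / 2 : ℝ)) *
      ∫⁻ t in Ioc 0 x, ENNReal.ofReal (t ^ (1 / 2 : ℝ)) * ‖f t‖ₑ ^ 2) := by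
        gcongr
        exact (pow_le_pow_left' hI 2).trans hCS
    _ = _ := by
        rw [← mul_assoc, ← ENNReal.ofReal_mul (Real.rpow_nonneg hx.le _)]
        congr 2
        rw [mul_left_comm, ← Real.rpow_add hx]
        norm_num

theorem lintegral_hardyFun_sq_le (f : L2) :
    ∫⁻ x, ‖hardyFun f x‖ₑ ^ 2 ∂unitMeasure ≤ 4 * ∫⁻ x, ‖f x‖ₑ ^ 2 ∂unitMeasure := by
  have hfm : Measurable (fun t : ℝ => ‖f t‖ₑ) := (Lp.stronglyMeasurable f).measurable.enorm
  have hIoc (g : ℝ → ℝ≥0∞) : ∫⁻ x, g x ∂unitMeasure = ∫⁻ x in Ioc 0 1, g x := by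
    rw [unitMeasure, ← restrict_Ioc_eq_restrict_Icc]
  rw [hIoc, hIoc]
  let K : ℝ → ℝ → ℝ≥0∞ := fun x t => {p : ℝ × ℝ | p.2 ≤ p.1}.indicator
    (fun p => ENNReal.ofReal (2 * p.1 ^ (-(3 / 2) : ℝ)) *
      (ENNReal.ofReal (p.2 ^ (1 / 2 : ℝ)) * ‖f p.2‖ₑ ^ 2)) (x, t)
  have hK : Measurable (Function.uncurry K) := by
    refine Measurable.indicator ?_ (measurableSet_le measurable_snd measurable_fst)
    have : Measurable (fun p : ℝ × ℝ => ‖f p.2‖ₑ) := hfm.comp measurable_snd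
    fun_prop
  calc ∫⁻ x in Ioc 0 1, ‖hardyFun f x‖ₑ ^ 2
      ≤ ∫⁻ x in Ioc 0 1, ∫⁻ t in Ioc 0 1, K x t := by
        refine setLIntegral_mono' measurableSet_Ioc (fun x hx => ?_)
        refine (enorm_hardyFun_sq_le f x hx.1).trans ?_
        rw [← lintegral_const_mul _ (by fun_prop)]
        calc _ = ∫⁻ t in Ioc 0 x, K x t := by
              refine setLIntegral_congr_fun measurableSet_Ioc (fun t ht => ?_)
              simp [K, ht.2]
          _ ≤ _ := lintegral_mono_set (Ioc_subset_Ioc_right hx.2)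
    _ = ∫⁻ t in Ioc 0 1, ∫⁻ x in Ioc 0 1, K x t := lintegral_lintegral_swap hK.aemeasurable
    _ ≤ ∫⁻ t in Ioc 0 1, 4 * ‖f t‖ₑ ^ 2 := by
        refine setLIntegral_mono' measurableSet_Ioc (fun t ht => ?_)
        calc ∫⁻ x in Ioc 0 1, K x t
            ≤ ∫⁻ x in Icc t 1, ENNReal.ofReal (2 * x ^ (-(3 / 2) : ℝ)) *
                (ENNReal.ofReal (t ^ (1 / 2 : ℝ)) * ‖f t‖ₑ ^ 2) := by
              rw [← lintegral_indicator measurableSet_Ioc, ← lintegral_indicator measurableSet_Icc]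
              refine lintegral_mono (fun x => ?_)
              by_cases h1 : x ∈ Ioc (0 : ℝ) 1
              · by_cases h2 : t ≤ x
                · simp [K, h1.1, h1.2, h2]
                · simp [K, h2]
              · rw [indicator_of_notMem h1]
                exact zero_le
          _ = (∫⁻ x in Icc t 1, ENNReal.ofReal (2 * x ^ (-(3 / 2) : ℝ))) *
                (ENNReal.ofReal (t ^ (1 / 2 : ℝ)) * ‖f t‖ₑ ^ 2) :=
              lintegral_mul_const _ (by fun_prop)
          _ ≤ ENNReal.ofReal (4 * t ^ (-(1 / 2) : ℝ)) *
                (ENNReal.ofReal (t ^ (1 / 2 : ℝ)) * ‖f t‖ₑ ^ 2) := by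
              gcongr
              exact lintegral_rpow_tail t ht.1 ht.2
          _ = 4 * ‖f t‖ₑ ^ 2 := by
              rw [← mul_assoc, ← ENNReal.ofReal_mul
                (mul_nonneg (by norm_num) (Real.rpow_nonneg ht.1.le _)),
                mul_assoc 4, ← Real.rpow_add ht.1]
              norm_num
    _ = 4 * ∫⁻ t in Ioc 0 1, ‖f t‖ₑ ^ 2 := lintegral_const_mul _ (by fun_prop)

theorem eLpNorm_hardyFun_le (f : L2) :
    eLpNorm (hardyFun f) 2 unitMeasure ≤ 2 * eLpNorm f 2 unitMeasure := by
  have h := lintegral_hardyFun_sq_le f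
  have e (g : ℝ → ℂ) : ∫⁻ x, ‖g x‖ₑ ^ 2 ∂unitMeasure = eLpNorm g 2 unitMeasure ^ 2 := by
    have := eLpNorm_nnreal_pow_eq_lintegral (f := g) (μ := unitMeasure) (p := 2) (by norm_num)
    norm_num at this
    exact this.symm
  rw [e, e, show (4 : ℝ≥0∞) = 2 ^ 2 by norm_num, ← mul_pow] at h
  exact (ENNReal.pow_le_pow_left_iff two_ne_zero).1 h

/-- Hardy: if `f ∈ L²[0,1]` then `x ↦ (1 / x) ∫₀ˣ f(t) dt` is in `L²[0,1]`. -/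
theorem memLp_hardyFun (f : L2) : MemLp (hardyFun f) 2 unitMeasure :=
  ⟨aestronglyMeasurable_hardyFun f, (eLpNorm_hardyFun_le f).trans_lt
    (ENNReal.mul_lt_top (by norm_num) (Lp.memLp f).2)⟩

theorem hardyFun_congr {f g : ℝ → ℂ} (h : f =ᵐ[unitMeasure] g) {x : ℝ}
    (hx : x ∈ Icc (0 : ℝ) 1) : hardyFun f x = hardyFun g x := by
  unfold hardyFun
  rw [intervalIntegral.integral_of_le hx.1, intervalIntegral.integral_of_le hx.1]
  congr 1
  refine integral_congr_ae (ae_restrict_of_ae_restrict_of_subset ?_ h)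
  exact Ioc_subset_Icc_self.trans (Icc_subset_Icc_right hx.2)

theorem intervalIntegrable_coe (f : L2) {x : ℝ} (hx : x ∈ Icc (0 : ℝ) 1) :
    IntervalIntegrable f volume 0 x := by
  rw [intervalIntegrable_iff_integrableOn_Ioc_of_le hx.1]
  exact (integrableOn_coe f).mono_set
    (Ioc_subset_Icc_self.trans (Icc_subset_Icc_right hx.2))

/-- The Hardy operator `H f(x) = (1 / x) ∫₀ˣ f(t) dt`, a bounded operator on `L²[0,1]`. -/
noncomputable def hardy : L2 →L[ℂ] L2 :=
  LinearMap.mkContinuous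
    { toFun := fun f => (memLp_hardyFun f).toLp
      map_add' := fun f g => by
        rw [← MemLp.toLp_add, MemLp.toLp_eq_toLp_iff]
        filter_upwards [ae_restrict_mem measurableSet_Icc] with x hx
        rw [hardyFun_congr (Lp.coeFn_add f g) hx]
        simp only [hardyFun, Pi.add_apply]
        rw [intervalIntegral.integral_add (intervalIntegrable_coe f hx)
          (intervalIntegrable_coe g hx), mul_add]
      map_smul' := fun c f => by
        rw [RingHom.id_apply, ← MemLp.toLp_const_smul, MemLp.toLp_eq_toLp_iff]
        filter_upwards [ae_restrict_mem measurableSet_Icc] with x hx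
        rw [hardyFun_congr (Lp.coeFn_smul c f) hx]
        simp only [hardyFun, Pi.smul_apply, smul_eq_mul]
        rw [intervalIntegral.integral_const_mul, mul_left_comm] }
    2
    (fun f => by
      change ‖(memLp_hardyFun f).toLp‖ ≤ 2 * ‖f‖
      rw [Lp.norm_toLp, Lp.norm_def]
      have h := ENNReal.toReal_mono
        (ENNReal.mul_ne_top (by norm_num) (Lp.memLp f).2.ne) (eLpNorm_hardyFun_le f)
      rwa [ENNReal.toReal_mul] at h)

/-- `v` is a cyclic vector for `T`: the span of `v, T v, T² v, …` is dense. -/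
def IsCyclicVector {E : Type*} [NormedAddCommGroup E] [NormedSpace ℂ E]
    (T : E →L[ℂ] E) (v : E) : Prop :=
  Dense (Submodule.span ℂ (Set.range fun n : ℕ => (T ^ n) v) : Set E)

end HardyOp

open Polynomial ComplexConjugate

namespace HardyOp

/-! Every `x^s` is an eigenvector of `H`, and `(1 + s H*) x^s = 1`. Clearing denominators gives
`q(H*) f = p(H*) 1`, where `p/q = ∑ c_j / (1 + s_j X)`. Hence `f` is cyclic once `1` is cyclic and
`p(H*)` has dense range.

Both rest on `‖g‖² - ‖g - H g‖² = |⟨g, 1⟩|²`. It makes `1 - H` a contraction, so `Re ⟨H g, g⟩ ≥ 0`,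
which yields cyclicity of `1` (`isCyclicVector_one`). It also excludes eigenvalues of `H` outside
the disc `|ν - 1| < 1`, so `H* - μ` has dense range when `|μ - 1| ≥ 1`.

Finally `⟨f, x^t⟩ = λ p(λ) / q(λ)` with `λ = 1 / (1 + conj t)`, and these `λ` fill the disc. The
hypothesis on `f` therefore keeps all roots of `p` outside it. -/

/-- The exponent `n ∈ ℕ` as a point of the half plane. -/
def natExponent (n : ℕ) : HalfPlane :=
  ⟨(n : ℂ), by rw [Complex.natCast_re]; have := n.cast_nonneg (α := ℝ); linarith⟩

/-! ### Monomials: inner products and eigenvalues of `H` -/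

theorem coeFn_monomial (s : HalfPlane) :
    monomial s =ᵐ[unitMeasure] fun x : ℝ => (x : ℂ) ^ (s : ℂ) :=
  (memLp_monomial s).coeFn_toLp

theorem add_one_ne_zero_of_halfPlane (s : HalfPlane) : (s : ℂ) + 1 ≠ 0 := by
  intro h
  have h' := congrArg Complex.re h
  have := s.2
  simp at h'
  linarith

theorem conj_add_add_one_ne_zero (s t : HalfPlane) : conj (s : ℂ) + t + 1 ≠ 0 := by
  intro h
  have h' := congrArg Complex.re h
  have := s.2
  have := t.2
  simp at h'
  linarith

theorem integral_unitMeasure (g : ℝ → ℂ) : ∫ x, g x ∂unitMeasure = ∫ x in (0 : ℝ)..1, g x := by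
  rw [intervalIntegral.integral_of_le zero_le_one, unitMeasure, integral_Icc_eq_integral_Ioc]

theorem inner_monomial_monomial (s t : HalfPlane) :
    inner ℂ (monomial s) (monomial t) = (conj (s : ℂ) + t + 1)⁻¹ := by
  rw [L2.inner_def]
  have h1 : ∫ x, inner ℂ (monomial s x) (monomial t x) ∂unitMeasure =
      ∫ x in (0 : ℝ)..1, (x : ℂ) ^ (conj (s : ℂ) + t) := by
    rw [← integral_unitMeasure]
    refine integral_congr_ae ?_
    have h0 : ∀ᵐ x ∂unitMeasure, x ∈ Ioc (0 : ℝ) 1 := by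
      rw [unitMeasure, ← restrict_Ioc_eq_restrict_Icc]
      exact ae_restrict_mem measurableSet_Ioc
    filter_upwards [coeFn_monomial s, coeFn_monomial t, h0] with x hs ht hx
    have hx0 : (x : ℂ) ≠ 0 := by exact_mod_cast hx.1.ne'
    have harg : (x : ℂ).arg ≠ Real.pi := by
      rw [Complex.arg_ofReal_of_nonneg hx.1.le]; exact Real.pi_pos.ne
    rw [hs, ht, RCLike.inner_apply, Complex.cpow_add _ _ hx0, mul_comm,
      Complex.cpow_conj _ _ harg, Complex.conj_ofReal]
  have hre : -1 < (conj (s : ℂ) + t).re := by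
    have := s.2
    have := t.2
    simp
    linarith
  rw [h1, integral_cpow (Or.inl hre), Complex.ofReal_one, Complex.one_cpow, Complex.ofReal_zero,
    Complex.zero_cpow (conj_add_add_one_ne_zero s t), sub_zero, one_div]

theorem hardy_monomial (s : HalfPlane) :
    hardy (monomial s) = ((s : ℂ) + 1)⁻¹ • monomial s := by
  change (memLp_hardyFun (monomial s)).toLp = _
  refine Lp.ext ?_
  have h0 : ∀ᵐ x ∂unitMeasure, x ∈ Ioc (0 : ℝ) 1 := by
    rw [unitMeasure, ← restrict_Ioc_eq_restrict_Icc]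
    exact ae_restrict_mem measurableSet_Ioc
  filter_upwards [(memLp_hardyFun (monomial s)).coeFn_toLp, coeFn_monomial s,
    Lp.coeFn_smul ((s : ℂ) + 1)⁻¹ (monomial s), h0] with x h1 h2 h3 hx
  have hx0 : (x : ℂ) ≠ 0 := by exact_mod_cast hx.1.ne'
  have hre : -1 < (s : ℂ).re := by have := s.2; linarith
  rw [h1, h3, Pi.smul_apply, h2, hardyFun_congr (coeFn_monomial s) ⟨hx.1.le, hx.2⟩, hardyFun,
    integral_cpow (Or.inl hre), Complex.ofReal_zero,
    Complex.zero_cpow (add_one_ne_zero_of_halfPlane s), Complex.cpow_add _ _ hx0,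
    Complex.cpow_one, sub_zero, smul_eq_mul]
  field_simp

/-! ### Density of the polynomials -/

/-- A function in `L²[0,1]` all of whose moments vanish is zero. -/
theorem eq_zero_of_inner_monomial_eq_zero {g : L2}
    (hg : ∀ n : ℕ, inner ℂ (monomial (natExponent n)) g = 0) : g = 0 := by
  have hgi : Integrable g unitMeasure := integrableOn_coe g
  have hmul (φ : ℝ → ℝ) (hφ : Continuous φ) :
      Integrable (fun x => (φ x : ℂ) * g x) unitMeasure :=
    IntegrableOn.continuousOn_mul (μ := volume) (by fun_prop) (integrableOn_coe g) isCompact_Icc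
  have hpow (n : ℕ) : ∫ x, ((x ^ n : ℝ) : ℂ) * g x ∂unitMeasure = 0 := by
    rw [← hg n, L2.inner_def]
    refine integral_congr_ae ?_
    filter_upwards [coeFn_monomial (natExponent n)] with x hx
    rw [hx, RCLike.inner_apply, natExponent, Complex.cpow_natCast, mul_comm]
    simp
  have hpoly (p : ℝ[X]) : ∫ x, ((p.eval x : ℝ) : ℂ) * g x ∂unitMeasure = 0 := by
    induction p using Polynomial.induction_on' with
    | add p q hp hq =>
      simp only [eval_add, Complex.ofReal_add, add_mul]
      rw [integral_add (hmul _ p.continuous) (hmul _ q.continuous), hp, hq, add_zero]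
    | monomial n a =>
      simp only [eval_monomial, Complex.ofReal_mul, mul_assoc]
      rw [integral_const_mul, hpow, mul_zero]
  -- Weierstrass approximation; the tolerance `ε / (C + 1)` allows for `C = 0`.
  have hcont (φ : ℝ → ℝ) (hφ : Continuous φ) : ∫ x, (φ x : ℂ) * g x ∂unitMeasure = 0 := by
    rw [← norm_le_zero_iff]
    refine le_of_forall_pos_le_add fun ε hε => ?_
    set C := ∫ x, ‖g x‖ ∂unitMeasure with hC
    have hC0 : 0 ≤ C := integral_nonneg fun x => norm_nonneg _
    obtain ⟨p, hp⟩ := exists_polynomial_near_of_continuousOn 0 1 φ hφ.continuousOn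
      (ε / (C + 1)) (by positivity)
    have h1 : ∫ x, (φ x : ℂ) * g x ∂unitMeasure =
        ∫ x, ((φ x : ℂ) * g x - ((p.eval x : ℝ) : ℂ) * g x) ∂unitMeasure := by
      rw [integral_sub (hmul _ hφ) (hmul _ p.continuous), hpoly, sub_zero]
    rw [h1, zero_add]
    calc _ ≤ ∫ x, ε / (C + 1) * ‖g x‖ ∂unitMeasure := by
          refine norm_integral_le_of_norm_le (hgi.norm.const_mul _) ?_
          filter_upwards [ae_restrict_mem measurableSet_Icc] with x hx
          rw [← sub_mul, norm_mul, ← Complex.ofReal_sub, Complex.norm_real, norm_sub_rev]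
          exact mul_le_mul_of_nonneg_right (hp x hx).le (norm_nonneg _)
      _ = ε / (C + 1) * C := by rw [integral_const_mul]
      _ ≤ ε := by
          rw [div_mul_eq_mul_div, div_le_iff₀ (by positivity)]
          nlinarith
  have hae : ∀ᵐ x ∂volume, (Icc (0 : ℝ) 1).indicator g x = 0 := by
    refine ae_eq_zero_of_integral_contDiff_smul_eq_zero ?_ fun φ hφ _ => ?_
    · exact ((integrable_indicator_iff measurableSet_Icc).2 (integrableOn_coe g)).locallyIntegrable
    · rw [← hcont φ hφ.continuous, ← integral_indicator measurableSet_Icc]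
      congr 1 with x
      by_cases hx : x ∈ Icc (0 : ℝ) 1 <;> simp [hx]
  refine (Lp.eq_zero_iff_ae_eq_zero).2 ?_
  filter_upwards [ae_restrict_of_ae hae, ae_restrict_mem measurableSet_Icc] with x hx hx'
  simpa [hx'] using hx

theorem topologicalClosure_span_monomial :
    (Submodule.span ℂ (range fun n => monomial (natExponent n))).topologicalClosure = ⊤ := by
  rw [Submodule.topologicalClosure_eq_top_iff, Submodule.eq_bot_iff]
  intro g hg
  exact eq_zero_of_inner_monomial_eq_zero fun n =>
    (Submodule.mem_orthogonal _ g).1 hg _ (Submodule.subset_span (mem_range_self n))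

/-! ### Two identities for `H` and `H*` -/

theorem inner_monomial_adjoint_hardy (t : HalfPlane) (g : L2) :
    inner ℂ (monomial t) (ContinuousLinearMap.adjoint hardy g) =
      (conj (t : ℂ) + 1)⁻¹ * inner ℂ (monomial t) g := by
  rw [ContinuousLinearMap.adjoint_inner_right, hardy_monomial, inner_smul_left]
  simp

theorem ext_inner_monomial {g h : L2} (hgh : ∀ n : ℕ,
    inner ℂ (monomial (natExponent n)) g = inner ℂ (monomial (natExponent n)) h) : g = h :=
  sub_eq_zero.1 <| eq_zero_of_inner_monomial_eq_zero fun n => by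
    rw [inner_sub_right, hgh, sub_self]

theorem natExponent_zero_coe : (natExponent 0 : ℂ) = 0 := by simp [natExponent]

theorem conj_add_one_ne_zero (s : HalfPlane) : conj (s : ℂ) + 1 ≠ 0 := by
  have := conj_add_add_one_ne_zero s (natExponent 0)
  rwa [natExponent_zero_coe, add_zero] at this

/-- `(1 + s H*) x ^ s = 1`. -/
theorem monomial_add_smul_adjoint_hardy (s : HalfPlane) :
    monomial s + (s : ℂ) • ContinuousLinearMap.adjoint hardy (monomial s) =
      monomial (natExponent 0) := by
  -- Against `x^n`: `(1 + s/(n+1)) / (n+s+1) = 1/(n+1)`.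
  refine ext_inner_monomial fun n => ?_
  have h1 := conj_add_add_one_ne_zero (natExponent n) s
  have h2 := conj_add_one_ne_zero (natExponent n)
  rw [inner_add_right, inner_smul_right, inner_monomial_adjoint_hardy, inner_monomial_monomial,
    inner_monomial_monomial, natExponent_zero_coe, add_zero]
  field_simp
  ring

/-- `‖f‖² - ‖f - H f‖² = |⟪1, f⟫|²`, polarised. -/
theorem inner_sub_inner_sub_hardy (f g : L2) :
    inner ℂ f g - inner ℂ (f - hardy f) (g - hardy g) =
      inner ℂ f (monomial (natExponent 0)) * inner ℂ (monomial (natExponent 0)) g := by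
  let A : L2 →L[ℂ] L2 := 1 - hardy
  let e := monomial (natExponent 0)
  -- `1 - A*A` is the rank one operator `e ⊗ e`. On monomials this reads `(1 - nm/((n+1)(m+1))) /
  -- (n+m+1) = 1/((n+1)(m+1))`; density does the rest.
  have key : (1 : L2 →L[ℂ] L2) - ContinuousLinearMap.adjoint A * A =
      (innerSL ℂ e).smulRight e := by
    refine ContinuousLinearMap.ext_on (s := range fun n => monomial (natExponent n)) ?_ ?_
    · rw [Submodule.dense_iff_topologicalClosure_eq_top]
      exact topologicalClosure_span_monomial
    · rintro _ ⟨m, rfl⟩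
      refine ext_inner_monomial fun n => ?_
      have h1 := conj_add_add_one_ne_zero (natExponent n) (natExponent m)
      have h2 := conj_add_one_ne_zero (natExponent n)
      have h3 := add_one_ne_zero_of_halfPlane (natExponent m)
      simp only [sub_apply, one_apply_eq_self,
        mul_apply_eq_comp, ContinuousLinearMap.smulRight_apply, innerSL_apply_apply, A, e,
        inner_sub_right, inner_sub_left, inner_smul_right, inner_smul_left,
        ContinuousLinearMap.adjoint_inner_right, hardy_monomial, inner_monomial_monomial,
        natExponent_zero_coe, map_inv₀, map_add, map_one, map_zero, add_zero, zero_add]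
      field_simp
      ring
  have h := congrArg (fun B : L2 →L[ℂ] L2 => inner ℂ f (B g)) key
  simp only [sub_apply, one_apply_eq_self,
    mul_apply_eq_comp, ContinuousLinearMap.smulRight_apply, innerSL_apply_apply,
    inner_sub_right f, inner_smul_right f, ContinuousLinearMap.adjoint_inner_right] at h
  rw [mul_comm]
  exact h

theorem norm_sq_sub_norm_sub_hardy_sq (g : L2) :
    ‖g‖ ^ 2 - ‖g - hardy g‖ ^ 2 = ‖inner ℂ (monomial (natExponent 0)) g‖ ^ 2 := by
  have h := inner_sub_inner_sub_hardy g g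
  rw [inner_self_eq_norm_sq_to_K, inner_self_eq_norm_sq_to_K, ← inner_conj_symm g,
    RCLike.conj_mul] at h
  exact_mod_cast h

/-! ### Cyclic vectors and polynomials in an operator -/

section Cyclic

variable {E : Type*} [NormedAddCommGroup E] [NormedSpace ℂ E]

theorem aeval_apply_mem_span_range_pow (T : E →L[ℂ] E) (v : E) (p : ℂ[X]) :
    aeval T p v ∈ Submodule.span ℂ (range fun n : ℕ => (T ^ n) v) := by
  rw [aeval_eq_sum_range, sum_apply]
  refine Submodule.sum_mem _ fun i _ => ?_
  rw [smul_apply]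
  exact Submodule.smul_mem _ _ (Submodule.subset_span (mem_range_self i))

theorem IsCyclicVector.denseRange_aeval {T : E →L[ℂ] E} {v : E} (h : IsCyclicVector T v) :
    DenseRange fun p : ℂ[X] => aeval T p v := by
  let φ : ℂ[X] →ₗ[ℂ] E :=
    { toFun := fun p => aeval T p v
      map_add' := fun p q => by simp
      map_smul' := fun a p => by simp }
  have hle : Submodule.span ℂ (range fun n : ℕ => (T ^ n) v) ≤ LinearMap.range φ := by
    rw [Submodule.span_le]
    rintro _ ⟨n, rfl⟩
    exact ⟨X ^ n, by simp [φ]⟩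
  exact h.mono fun x hx => hle hx

/-- If `q(T) f = p(T) v` with `v` cyclic and `p(T)` of dense range, then `f` is cyclic. -/
theorem IsCyclicVector.of_aeval_eq {T : E →L[ℂ] E} {v f : E} (h : IsCyclicVector T v)
    {p q : ℂ[X]} (hp : DenseRange (aeval T p)) (hq : aeval T q f = aeval T p v) :
    IsCyclicVector T f := by
  refine (hp.comp h.denseRange_aeval (aeval T p).continuous).mono ?_
  rintro _ ⟨r, rfl⟩
  -- Polynomials in `T` commute, so `p(T) r(T) v = r(T) p(T) v = r(T) q(T) f`.
  have : aeval T p (aeval T r v) = aeval T (r * q) f := by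
    rw [map_mul, mul_apply_eq_comp, hq, ← mul_apply_eq_comp, ← mul_apply_eq_comp, ← map_mul,
      ← map_mul, mul_comm]
  simp only [Function.comp_apply, this]
  exact aeval_apply_mem_span_range_pow T f _

/-- Over `ℂ`, `p` splits into linear factors, and continuous maps of dense range compose. -/
theorem denseRange_aeval_of_roots {T : E →L[ℂ] E} {p : ℂ[X]} (hp : p ≠ 0)
    (h : ∀ μ ∈ p.roots, DenseRange (aeval T (X - C μ))) : DenseRange (aeval T p) := by
  have hprod (m : Multiset ℂ) (hm : ∀ μ ∈ m, DenseRange (aeval T (X - C μ))) :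
      DenseRange (aeval T (m.map fun μ => X - C μ).prod) := by
    induction m using Multiset.induction_on with
    | empty => simpa using! denseRange_id
    | cons μ m ih =>
      rw [Multiset.map_cons, Multiset.prod_cons, map_mul]
      exact (hm μ (Multiset.mem_cons_self μ m)).comp
        (ih fun ν hν => hm ν (Multiset.mem_cons_of_mem hν)) (aeval T (X - C μ)).continuous
  rw [(IsAlgClosed.splits p).eq_prod_roots, map_mul]
  refine DenseRange.comp (g := aeval T (C p.leadingCoeff)) ?_ (hprod _ h)
    (aeval T (C p.leadingCoeff)).continuous
  refine Function.Surjective.denseRange fun x => ⟨p.leadingCoeff⁻¹ • x, ?_⟩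
  rw [aeval_C, Algebra.algebraMap_eq_smul_one, smul_apply, one_apply_eq_self, smul_smul,
    mul_inv_cancel₀ (leadingCoeff_ne_zero.2 hp), one_smul]

end Cyclic

section CyclicInner

variable {E : Type*} [NormedAddCommGroup E] [InnerProductSpace ℂ E] [CompleteSpace E]

theorem isCyclicVector_iff_inner {T : E →L[ℂ] E} {v : E} :
    IsCyclicVector T v ↔ ∀ g, (∀ n : ℕ, inner ℂ ((T ^ n) v) g = 0) → g = 0 := by
  rw [IsCyclicVector, Submodule.dense_iff_topologicalClosure_eq_top,
    Submodule.topologicalClosure_eq_top_iff, Submodule.eq_bot_iff]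
  refine forall_congr' fun g => imp_congr_left ?_
  rw [← Submodule.span_singleton_le_iff_mem, ← Submodule.isOrtho_iff_le, Submodule.isOrtho_comm,
    Submodule.isOrtho_span]
  simp

end CyclicInner

/-! ### Cyclicity of the constant function -/

theorem norm_sub_hardy_le (g : L2) : ‖g - hardy g‖ ≤ ‖g‖ := by
  refine le_of_sq_le_sq ?_ (norm_nonneg _)
  have := norm_sq_sub_norm_sub_hardy_sq g
  have := sq_nonneg ‖inner ℂ (monomial (natExponent 0)) g‖
  linarith

theorem re_inner_hardy_nonneg (g : L2) : 0 ≤ (inner ℂ g (hardy g)).re := by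
  have h1 : (inner ℂ g (g - hardy g)).re ≤ ‖g‖ * ‖g‖ :=
    (re_inner_le_norm (𝕜 := ℂ) g _).trans
      (mul_le_mul_of_nonneg_left (norm_sub_hardy_le g) (norm_nonneg g))
  have h2 : (inner ℂ g g : ℂ).re = ‖g‖ * ‖g‖ := inner_self_eq_norm_mul_norm (𝕜 := ℂ) g
  rw [inner_sub_right, Complex.sub_re] at h1
  linarith

/-- The orthogonal complement `Sᗮ` is `H`-invariant. If `w` is the projection of `x^n` to it,
pairing `(1 + n H*) x^n = 1` with `w` gives `‖w‖² + n ⟨w, H w⟩ = 0`. Accretivity of `H` forces `w =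
0`, so every `x^n` is orthogonal to `Sᗮ`. -/
theorem isCyclicVector_one :
    IsCyclicVector (ContinuousLinearMap.adjoint hardy) (monomial (natExponent 0)) := by
  set S := Submodule.span ℂ (range fun n : ℕ =>
    (ContinuousLinearMap.adjoint hardy ^ n) (monomial (natExponent 0))) with hS
  have hmem (g : L2) : g ∈ Sᗮ ↔ ∀ n : ℕ,
      inner ℂ ((ContinuousLinearMap.adjoint hardy ^ n) (monomial (natExponent 0))) g = 0 := by
    rw [← Submodule.span_singleton_le_iff_mem, ← Submodule.isOrtho_iff_le, Submodule.isOrtho_comm,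
      hS, Submodule.isOrtho_span]
    simp
  have hinv {g : L2} (hg : g ∈ Sᗮ) : hardy g ∈ Sᗮ := by
    rw [hmem] at hg ⊢
    intro n
    rw [← ContinuousLinearMap.adjoint_inner_left, ← mul_apply_eq_comp, ← pow_succ']
    exact hg (n + 1)
  have horth (n : ℕ) : monomial (natExponent n) ∈ Sᗮᗮ := by
    set v := monomial (natExponent n)
    set w := Sᗮ.starProjection v
    have hw : w ∈ Sᗮ := Submodule.starProjection_apply_mem _ v
    have hproj {g : L2} (hg : g ∈ Sᗮ) : inner ℂ v g = inner ℂ w g := by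
      rw [← sub_eq_zero, ← inner_sub_left]
      exact Submodule.starProjection_inner_eq_zero v g hg
    have h1 : inner ℂ (v + (n : ℂ) • ContinuousLinearMap.adjoint hardy v) w = 0 := by
      have := monomial_add_smul_adjoint_hardy (natExponent n)
      rw [show ((natExponent n : HalfPlane) : ℂ) = n from rfl] at this
      rw [this]
      exact (hmem w).1 hw 0
    rw [inner_add_left, inner_smul_left, ContinuousLinearMap.adjoint_inner_left, hproj hw,
      hproj (hinv hw), Complex.conj_natCast] at h1
    have h2 := congrArg Complex.re h1
    have h3 : (inner ℂ w w : ℂ).re = ‖w‖ * ‖w‖ := inner_self_eq_norm_mul_norm (𝕜 := ℂ) w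
    have h4 : 0 ≤ (n : ℝ) * (inner ℂ w (hardy w)).re :=
      mul_nonneg n.cast_nonneg (re_inner_hardy_nonneg w)
    rw [Complex.add_re, h3, ← Complex.ofReal_natCast, Complex.re_ofReal_mul, Complex.zero_re] at h2
    have hw0 : w = 0 := by
      rw [← norm_eq_zero, ← mul_self_eq_zero]
      exact le_antisymm (by linarith) (mul_self_nonneg _)
    rw [Submodule.mem_orthogonal']
    intro g hg
    rw [hproj hg, hw0, inner_zero_left]
  rw [isCyclicVector_iff_inner]
  intro g hg
  exact eq_zero_of_inner_monomial_eq_zero fun n =>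
    (Submodule.mem_orthogonal' _ _).1 (horth n) g ((hmem g).2 hg)

/-! ### Dense range of `H* - μ` off the disc -/

/-- `H` has no eigenvalue outside the open disc `|ν - 1| < 1`. -/
theorem eq_zero_of_hardy_eq_smul {ν : ℂ} (hν : 1 ≤ ‖ν - 1‖) {g : L2} (hg : hardy g = ν • g) :
    g = 0 := by
  -- Here `‖g - H g‖ = |ν - 1| ‖g‖ ≥ ‖g‖`, so the norm identity leaves no room for `⟨g, 1⟩`.
  have h1 : inner ℂ (monomial (natExponent 0)) g = 0 := by
    have h := norm_sq_sub_norm_sub_hardy_sq g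
    have h2 : ‖g - hardy g‖ = ‖ν - 1‖ * ‖g‖ := by
      rw [hg, norm_sub_rev, ← norm_smul, sub_smul, one_smul]
    have h3 : ‖g‖ ^ 2 ≤ ‖g - hardy g‖ ^ 2 := by
      rw [h2]
      exact pow_le_pow_left₀ (norm_nonneg g) (le_mul_of_one_le_left (norm_nonneg g) hν) 2
    rw [← norm_eq_zero, ← sq_eq_zero_iff]
    exact le_antisymm (by linarith) (sq_nonneg _)
  refine isCyclicVector_iff_inner.1 isCyclicVector_one g fun n => ?_
  induction n with
  | zero => exact h1
  | succ n ih =>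
    rw [pow_succ', mul_apply_eq_comp, ContinuousLinearMap.adjoint_inner_left, hg,
      inner_smul_right, ih, mul_zero]

/-- The orthogonal complement of the range is the kernel of `H - conj μ`. -/
theorem denseRange_adjoint_hardy_sub {μ : ℂ} (hμ : 1 ≤ ‖μ - 1‖) :
    DenseRange (aeval (ContinuousLinearMap.adjoint hardy) (X - C μ)) := by
  set B := aeval (ContinuousLinearMap.adjoint hardy) (X - C μ) with hB
  have hBg (g : L2) : B g = ContinuousLinearMap.adjoint hardy g - μ • g := by
    rw [hB, map_sub, aeval_X, aeval_C, Algebra.algebraMap_eq_smul_one, sub_apply, smul_apply,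
      one_apply_eq_self]
  change Dense (B.range : Set L2)
  rw [Submodule.dense_iff_topologicalClosure_eq_top, Submodule.topologicalClosure_eq_top_iff,
    Submodule.eq_bot_iff]
  intro g hg
  refine eq_zero_of_hardy_eq_smul (ν := conj μ) ?_ ?_
  · rwa [← RCLike.norm_conj, map_sub, map_one] at hμ
  · refine ext_inner_left ℂ fun h => ?_
    have := (Submodule.mem_orthogonal _ g).1 hg (B h) ⟨h, rfl⟩
    rw [hBg, inner_sub_left, ContinuousLinearMap.adjoint_inner_left, inner_smul_left,
      sub_eq_zero] at this
    rw [this, inner_smul_right]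

/-! ### `f` as a rational function of `H*` applied to `1` -/

section Numerator

variable {ι : Type*} [DecidableEq ι] (I : Finset ι) (c : ι → ℂ) (s : ι → HalfPlane)

/-- The product of the factors `1 + s i * X`. -/
noncomputable def denominator : ℂ[X] := ∏ i ∈ I, (1 + C (s i : ℂ) * X)

/-- The numerator of `∑ i, c i / (1 + s i * X)` over the common denominator. -/
noncomputable def numerator : ℂ[X] := ∑ j ∈ I, C (c j) * denominator (I.erase j) s

theorem aeval_adjoint_hardy_monomial (t : HalfPlane) :
    aeval (ContinuousLinearMap.adjoint hardy) (1 + C (t : ℂ) * X) (monomial t) =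
      monomial (natExponent 0) := by
  rw [← monomial_add_smul_adjoint_hardy t]
  simp [Algebra.algebraMap_eq_smul_one]

theorem aeval_denominator_sum_monomial :
    aeval (ContinuousLinearMap.adjoint hardy) (denominator I s) (∑ j ∈ I, c j • monomial (s j)) =
      aeval (ContinuousLinearMap.adjoint hardy) (numerator I c s) (monomial (natExponent 0)) := by
  rw [numerator, map_sum, map_sum, sum_apply]
  refine Finset.sum_congr rfl fun j hj => ?_
  rw [denominator, ← Finset.mul_prod_erase I _ hj, mul_comm, map_mul, mul_apply_eq_comp, map_smul,
    aeval_adjoint_hardy_monomial, map_smul, map_mul, aeval_C, Algebra.algebraMap_eq_smul_one,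
    smul_one_mul, smul_apply, denominator]

/-- With `λ = 1/(conj t + 1)`, each term is `1/(conj t + s_j + 1) = λ/(1 + s_j λ)`. This turns zeros
of `p` in the disc into zeros of `⟨f, x^t⟩`. -/
theorem inner_monomial_sum_monomial (t : HalfPlane) :
    inner ℂ (monomial t) (∑ j ∈ I, c j • monomial (s j)) *
        (denominator I s).eval (conj (t : ℂ) + 1)⁻¹ =
      (conj (t : ℂ) + 1)⁻¹ * (numerator I c s).eval (conj (t : ℂ) + 1)⁻¹ := by
  rw [inner_sum, Finset.sum_mul, numerator, eval_finsetSum, Finset.mul_sum]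
  refine Finset.sum_congr rfl fun j hj => ?_
  have h1 := conj_add_add_one_ne_zero t (s j)
  have h2 := conj_add_one_ne_zero t
  rw [denominator, ← Finset.mul_prod_erase I _ hj, inner_smul_right, inner_monomial_monomial,
    eval_mul, eval_mul, eval_C, ← denominator]
  simp only [eval_add, eval_one, eval_mul, eval_C, eval_X]
  field_simp
  ring

end Numerator

/-! ### The disc, the half plane and the conclusion -/

/-- `w ↦ 1 / (1 + conj w)` maps the half plane onto the disc `|μ - 1| < 1`. -/
theorem exists_eq_inv_conj_add_one {μ : ℂ} (hμ : ‖μ - 1‖ < 1) :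
    ∃ t : HalfPlane, μ = (conj (t : ℂ) + 1)⁻¹ := by
  have h0 : μ ≠ 0 := by
    rintro rfl
    simp at hμ
  -- `|μ - 1| < 1` means `|μ|² < 2 Re μ`, i.e. `Re (1/μ) > 1/2`.
  have hsq : μ.re ^ 2 + μ.im ^ 2 < 2 * μ.re := by
    have h := (sq_lt_one_iff₀ (norm_nonneg _)).2 hμ
    rw [Complex.sq_norm, Complex.normSq_apply] at h
    simp at h
    linarith
  refine ⟨⟨conj (μ⁻¹ - 1), ?_⟩, by simp⟩
  have hpos : 0 < Complex.normSq μ := Complex.normSq_pos.2 h0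
  rw [Complex.conj_re, Complex.sub_re, Complex.inv_re, Complex.one_re, lt_sub_iff_add_lt,
    lt_div_iff₀ hpos, Complex.normSq_apply]
  linarith

end HardyOp

theorem lemma6p2 (N : ℕ) (c : Fin (N + 1) → ℂ) (s : Fin (N + 1) → HardyOp.HalfPlane)
    (f : HardyOp.L2) (hf : f = ∑ j, c j • HardyOp.monomial (s j))
    (hne : ∀ t : HardyOp.HalfPlane, inner ℂ (HardyOp.monomial t) f ≠ 0) :
    HardyOp.IsCyclicVector (ContinuousLinearMap.adjoint HardyOp.hardy) f := by
  have hden (t : HardyOp.HalfPlane) :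
      (HardyOp.denominator Finset.univ s).eval (conj (t : ℂ) + 1)⁻¹ ≠ 0 := by
    rw [HardyOp.denominator, eval_prod]
    -- `1 + s_i λ = (conj t + s_i + 1) λ`, with `λ = 1/(conj t + 1)`.
    refine Finset.prod_ne_zero_iff.2 fun i _ h => HardyOp.conj_add_add_one_ne_zero t (s i) ?_
    have h2 := HardyOp.conj_add_one_ne_zero t
    simp only [eval_add, eval_one, eval_mul, eval_C, eval_X] at h
    field_simp at h
    linear_combination h
  have hnum (t : HardyOp.HalfPlane) :
      (HardyOp.numerator Finset.univ c s).eval (conj (t : ℂ) + 1)⁻¹ ≠ 0 := fun h => by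
    have := HardyOp.inner_monomial_sum_monomial Finset.univ c s t
    rw [h, mul_zero, ← hf] at this
    exact mul_ne_zero (hne t) (hden t) this
  refine HardyOp.isCyclicVector_one.of_aeval_eq (p := HardyOp.numerator Finset.univ c s)
    (q := HardyOp.denominator Finset.univ s) ?_ ?_
  -- The exponent `t = 0` shows that the numerator is not the zero polynomial.
  · refine HardyOp.denseRange_aeval_of_roots (fun h => hnum (HardyOp.natExponent 0) ?_)
      fun μ hμ => HardyOp.denseRange_adjoint_hardy_sub (not_lt.1 fun hlt => ?_)
    · rw [h, eval_zero]
    · obtain ⟨t, rfl⟩ := HardyOp.exists_eq_inv_conj_add_one hlt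
      exact hnum t (isRoot_of_mem_roots hμ)
  · rw [hf]
    exact HardyOp.aeval_denominator_sum_monomial Finset.univ c s
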